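/- **Model.** A team of $n$ identical, autonomous robots moves in the Euclidean plane $\mathbb R^2$ in rounds $t=0,1,2,\dots$ Each robot has its own fixed local coordinate system: origin at its own current position, its own unit of length, axes of either handedness. A team is given by its size and by the nonempty set of assignments of coordinate systems to its robots that may occur. In each round a scheduler activates a set of robots; under *FSYNCH* ($F$) all robots in every round, under *SSYNCH* ($S$) an arbitrary nonempty set in each round such that every robot is activated infinitely often. The activated robots simultaneously Look, Compute and Move. Look returns the set of the visible robot positions in local coordinates: all positions under *full visibility* ($F.V.$); those within a fixed distance $V>0$ (the same for all robots) under *limited visibility* ($L.V.$). In the model $\mathcal{FSTA}$ each robot has an internal state (light) from a finite set, seen by itself only and initially off; Compute is a deterministic function, the same for all robots, from the own light and the snapshot to the new light and a destination, and the robot then moves straight to this destination. A problem for $n$ robots consists of a set of initial configurations and a set of admissible evolutions of the $n$ positions. A team $R$ *solves* it if some algorithm, for every coordinate assignment of $R$, every initial configuration whose visibility graph (robots joined when they can see each other) is connected, and every activation sequence of the scheduler, produces an admissible evolution. Let $\mathcal{FSTA}^{X}_{Y}(R)$ be the set of problems solvable by $R$ under scheduler $X$ and visibility $Y$. Write $\mathcal{FSTA}^{X_1}_{Y_1}\perp\mathcal{FSTA}^{X_2}_{Y_2}$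 (*incomparable*) if there are teams $R_1,R_2$ with $\mathcal{FSTA}^{X_1}_{Y_1}(R_1)\setminus\mathcal{FSTA}^{X_2}_{Y_2}(R_1)\ne\emptyset$ and $\mathcal{FSTA}^{X_2}_{Y_2}(R_2)\setminus\mathcal{FSTA}^{X_1}_{Y_1}(R_2)\neq\emptyset$. **Equivalent Oscillation (EqOsc).** Robots $r_1,r_2,r_3$ start at points $B,A,C$, where $B\ne C$ and $A$ is the midpoint of $BC$; put $d=AB=AC$, and let $B'\in AB$, $C'\in AC$ with $AB'=AC'=\frac{2d}3$. Required: $r_2$ stays at $A$; in every round $r_1$ and $r_3$ are equidistant from $A$; whenever $(r_1,r_3)$ is at $(B,C)$ in some round, it is at $(B',C')$ in some later round, and whenever it is at $(B',C')$, it is at $(B,C)$ in some later round. **Algorithm AlgEOSTA** (lights off, $N$, $F$). A robot lying halfway between two visible robots stays still, as does one that sees no other robot. Any other robot, whose closest visible robot is at position $P$ and distance $\delta$, moves on the line through $P$ and itself, staying on its side of $P$: if its light is off or $F$, it sets it to $N$ and moves to distance $\frac{2\delta}3$ from $P$; if its light is $N$, it sets it to $F$ and moves to distance $\frac{3\delta}2$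 from $P$. **Angle Equalization (AE).** Robots $r_1,r_2,r_3,r_4$ start at points $A,B,C,D$ in *Configuration (I)*: $A$ and $D$ lie strictly on the same side of the line $BC$, the ray $BA$ makes the angle $\theta_1$ with the prolongation of $CB$ beyond $B$, the ray $CD$ makes the angle $\theta_2$ with the prolongation of $BC$ beyond $C$, and $\theta_1<\theta_2<90^\circ$. Moreover the four points determine the roles of the robots: no other labelling of the same four points by $A,B,C,D$ is a Configuration (I). Required: $r_2$ and $r_3$ never move; no two robots ever collide; from some round on all robots stand still in *Configuration (II)*, in which $r_1$ and $r_4$ are on the same side of $BC$ as at the start and the rays from $B$ to $r_1$ and from $C$ to $r_4$ both make the original angle $\theta_2$ with the respective prolongations of $BC$. **Theorem.** For every visibility radius $V>0$, $$\mathcal{FSTA}_{L.V.}^{F}\perp\mathcal{FSTA}_{F.V.}^{S}.$$ More precisely: 1. for every team $R$ of three robots, AlgEOSTA solves EqOsc under FSYNCH with limited visibility, so $\mathrm{EqOsc}\in\mathcal{FSTA}^F_{L.V.}(R)$; but there is a team $R$ of three robots with $\mathrm{EqOsc}\notin\mathcal{FSTA}^S_{F.V.}(R)$; 2. for every team $R$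 of four robots $\mathrm{AE}\in\mathcal{FSTA}^S_{F.V.}(R)$; but there is a team $R$ of four robots with $\mathrm{AE}\notin\mathcal{FSTA}^F_{L.V.}(R)$. -/

import Mathlib

namespace Robots

/-- The Euclidean plane. -/
abbrev Plane : Type := EuclideanSpace ℝ (Fin 2)

/-- Positions of `n` robots; indices serve the analysis only, robots do not see them. -/
abbrev Config (n : ℕ) : Type := Fin n → Plane

/-- The axes (of either handedness) and the unit of length of a local coordinate system.
Its origin is always the current position of the robot that owns it. -/
structure Frame where
  scale : ℝ
  scale_pos : 0 < scale
  axes : Plane ≃ₗᵢ[ℝ] Plane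

noncomputable section

/-- Local coordinates of a displacement from the robot. -/
def Frame.toLocal (f : Frame) (v : Plane) : Plane := f.scale • f.axes v

/-- The displacement with given local coordinates. -/
def Frame.toGlobal (f : Frame) (w : Plane) : Plane := f.axes.symm (f.scale⁻¹ • w)

theorem Frame.toGlobal_toLocal (f : Frame) (v : Plane) : f.toGlobal (f.toLocal v) = v := by
  simp [Frame.toGlobal, Frame.toLocal, smul_smul, inv_mul_cancel₀ f.scale_pos.ne']

end

/-- A team of `n` identical robots, given by what its members may rely on about their local
coordinate systems: the (nonempty) set of assignments of coordinate systems that can occur.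
Constant assignments only: common coordinate system. All assignments: no agreement at all. -/
structure Team (n : ℕ) where
  frames : Set (Fin n → Frame)
  frames_nonempty : frames.Nonempty

/-- Full visibility, or visibility up to a fixed distance, the same for all robots. -/
inductive Visibility where
  | full : Visibility
  | limited (V : ℝ) : Visibility

/-- A robot at `p` observes position `q`. -/
def Visibility.Sees : Visibility → Plane → Plane → Prop
  | .full, _, _ => True
  | .limited V, p, q => dist p q ≤ V

/-- Two robots are adjacent when they can see each other. -/
def visibilityGraph {n : ℕ} (vis : Visibility) (p : Config n) : SimpleGraph (Fin n) :=
  SimpleGraph.fromRel (fun i j => vis.Sees (p i) (p j))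

/-- The result of Look by robot `i`: the set of all visible positions (its own, the origin,
included), without lights and identities, in the local coordinate system `f`. -/
def snapshot {n : ℕ} (vis : Visibility) (f : Frame) (p : Config n) (i : Fin n) : Set Plane :=
  {w | ∃ j, vis.Sees (p i) (p j) ∧ w = f.toLocal (p j - p i)}

inductive Scheduler where
  | fsynch : Scheduler
  | ssynch : Scheduler

/-- `act t` is the set of robots activated in round `t`. Fully synchronous: all robots, always.
Semi-synchronous: some robots in each round, every robot infinitely often. -/
def Scheduler.Admits {n : ℕ} : Scheduler → (ℕ → Set (Fin n)) → Prop
  | .fsynch, act => ∀ t, act t = Set.univ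
  | .ssynch, act => (∀ t, (act t).Nonempty) ∧ ∀ i t, ∃ t', t ≤ t' ∧ i ∈ act t'

/-- A deterministic algorithm of the model FSTA: a finite set of colors of the internal light,
the initial color, and the Compute step, which maps the own color and the snapshot to the
new color and the destination (in local coordinates). -/
structure Algorithm where
  Color : Type
  finite_color : Finite Color
  off : Color
  compute : Color → Set Plane → Color × Plane

noncomputable section

open Classical in
/-- One synchronous round, in which exactly the robots in `S` execute a Look-Compute-Move cycle. -/
def Algorithm.step (alg : Algorithm) {n : ℕ} (vis : Visibility) (fr : Fin n → Frame)
    (S : Set (Fin n)) (s : Fin n → Plane × alg.Color) : Fin n → Plane × alg.Color :=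
  fun i =>
    if i ∈ S then
      let r := alg.compute (s i).2 (snapshot vis (fr i) (fun j => (s j).1) i)
      ((s i).1 + (fr i).toGlobal r.2, r.1)
    else s i

/-- Positions and colors at the beginning of round `t`; all lights are initially off. -/
def Algorithm.state (alg : Algorithm) {n : ℕ} (vis : Visibility) (fr : Fin n → Frame)
    (act : ℕ → Set (Fin n)) (p : Config n) : ℕ → Fin n → Plane × alg.Color
  | 0 => fun i => (p i, alg.off)
  | t + 1 => alg.step vis fr (act t) (alg.state vis fr act p t)

/-- Positions at the beginning of round `t`. -/
def Algorithm.run (alg : Algorithm) {n : ℕ} (vis : Visibility) (fr : Fin n → Frame)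
    (act : ℕ → Set (Fin n)) (p : Config n) (t : ℕ) : Config n :=
  fun i => (alg.state vis fr act p t i).1

end

/-- A problem for `n` robots: the initial configurations, and the evolutions of the positions
over the rounds that meet the requirements. -/
structure Problem (n : ℕ) where
  init : Set (Config n)
  goal : Set (ℕ → Config n)

/-- `alg` solves `P` for the team `R`: for all possible local coordinate systems, from every
initial configuration with connected visibility graph, whatever the scheduler does. -/
def Solves (alg : Algorithm) {n : ℕ} (sch : Scheduler) (vis : Visibility) (R : Team n)
    (P : Problem n) : Prop :=
  ∀ fr ∈ R.frames, ∀ p ∈ P.init, (visibilityGraph vis p).Connected →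
    ∀ act : ℕ → Set (Fin n), sch.Admits act → alg.run vis fr act p ∈ P.goal

/-- The problems that the team `R` can solve in FSTA under the given scheduler and visibility. -/
def Task (sch : Scheduler) (vis : Visibility) {n : ℕ} (R : Team n) : Set (Problem n) :=
  {P | ∃ alg : Algorithm, Solves alg sch vis R P}

/-- Computational incomparability of FSTA in two settings. -/
def Incomparable (sch₁ : Scheduler) (vis₁ : Visibility) (sch₂ : Scheduler) (vis₂ : Visibility) :
    Prop :=
  (∃ (n : ℕ) (R : Team n), (Task sch₁ vis₁ R \ Task sch₂ vis₂ R).Nonempty) ∧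
  (∃ (n : ℕ) (R : Team n), (Task sch₂ vis₂ R \ Task sch₁ vis₁ R).Nonempty)

/-! Equivalent Oscillation -/

noncomputable section

/-- Robots `0`, `1`, `2` start at `B`, `A`, `C`, where `A` is the midpoint of the segment from `B`
to `C`. Robot `1` stays at `A`, the robots `0` and `2` are equidistant from it in every round,
and they oscillate between `B`, `C` and the points `B'`, `C'` at two thirds of the distance. -/
def EqOsc : Problem 3 where
  init := {p | p 0 ≠ p 2 ∧ p 1 = midpoint ℝ (p 0) (p 2)}
  goal := {x |
    let B := x 0 0
    let A := x 0 1
    let C := x 0 2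
    let B' := AffineMap.lineMap A B (2 / 3 : ℝ)
    let C' := AffineMap.lineMap A C (2 / 3 : ℝ)
    (∀ t, x t 1 = A) ∧
    (∀ t, dist (x t 0) (x t 1) = dist (x t 2) (x t 1)) ∧
    (∀ t, x t 0 = B ∧ x t 2 = C → ∃ t', t < t' ∧ x t' 0 = B' ∧ x t' 2 = C') ∧
    (∀ t, x t 0 = B' ∧ x t 2 = C' → ∃ t', t < t' ∧ x t' 0 = B ∧ x t' 2 = C)}

/-- The lights of `algEOSTA`: off, near, far. -/
inductive EOColor where
  | off : EOColor
  | N : EOColor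
  | F : EOColor

theorem EOColor.finite : Finite EOColor :=
  Finite.of_injective
    (fun c : EOColor => match c with | .off => (0 : Fin 3) | .N => 1 | .F => 2)
    (by intro a b h; cases a <;> cases b <;> simp_all)

/-- In the snapshot `S`, the robot at the origin lies halfway between two visible robots. -/
def IsMiddle (S : Set Plane) : Prop := ∃ v ∈ S, v ≠ 0 ∧ -v ∈ S

/-- `v` is a closest other robot in the snapshot `S`. -/
def IsClosest (S : Set Plane) (v : Plane) : Prop :=
  v ∈ S ∧ v ≠ 0 ∧ ∀ w ∈ S, w ≠ 0 → ‖v‖ ≤ ‖w‖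

open Classical in
/-- The algorithm AlgEOSTA. The middle robot remains static. A terminal robot, whose closest
robot at distance `d` is the middle one, moves on their line to distance `2d/3` from it and sets
its light to `N` if the light is off or `F`; it moves to distance `3d/2` and sets its light to `F`
if the light is `N`. -/
def algEOSTA : Algorithm where
  Color := EOColor
  finite_color := EOColor.finite
  off := .off
  compute := fun c S =>
    if h : ¬ IsMiddle S ∧ ∃ v, IsClosest S v then
      let v := h.2.choose
      match c with
      | .N => (.F, v - (3 / 2 : ℝ) • v)
      | _ => (.N, v - (2 / 3 : ℝ) • v)
    else (c, 0)

/-! Angle Equalization -/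

/-- The angle at `Q` between the ray `QP` and the prolongation of the segment `RQ` beyond `Q`. -/
def outerAngle (P Q R : Plane) : ℝ := InnerProductGeometry.angle (P - Q) (Q - R)

/-- `P` and `P'` lie strictly on the same side of the line `QR`. -/
def SameSide (Q R P P' : Plane) : Prop := (affineSpan ℝ {Q, R}).SSameSide P P'

/-- Configuration (I), with `A, B, C, D = p 0, p 1, p 2, p 3`: the lines `AB` and `DC` meet the
prolongations of the segment `BC` at acute angles `θ₁ < θ₂`, on the same side of `BC`. -/
def ConfigI (p : Config 4) : Prop :=
  SameSide (p 1) (p 2) (p 0) (p 3) ∧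
  outerAngle (p 0) (p 1) (p 2) < outerAngle (p 3) (p 2) (p 1) ∧
  outerAngle (p 3) (p 2) (p 1) < Real.pi / 2

/-- `q` is Configuration (II) for the initial configuration `p`: both angles are equal to the
larger initial angle `θ₂`, on the same side of `BC` as before. -/
def ConfigII (p q : Config 4) : Prop :=
  SameSide (p 1) (p 2) (p 0) (q 0) ∧ SameSide (p 1) (p 2) (p 3) (q 3) ∧
  outerAngle (q 0) (p 1) (p 2) = outerAngle (p 3) (p 2) (p 1) ∧
  outerAngle (q 3) (p 2) (p 1) = outerAngle (p 3) (p 2) (p 1)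

/-- No two robots ever meet, neither at the beginning of a round nor while they move
synchronously along straight segments to their destinations. -/
def CollisionFree {n : ℕ} (x : ℕ → Config n) : Prop :=
  ∀ t, ∀ i j, i ≠ j → ∀ u ∈ Set.Icc (0 : ℝ) 1,
    AffineMap.lineMap (x t i) (x (t + 1) i) u ≠ AffineMap.lineMap (x t j) (x (t + 1) j) u

/-- Robots `0`, `1`, `2`, `3` start at `A`, `B`, `C`, `D` in a Configuration (I) whose four points
determine who is who. They must form Configuration (II) and stay there, without collisions and
without ever moving robots `1` and `2`. -/
def AE : Problem 4 where
  init := {p | ConfigI p ∧ ∀ σ : Equiv.Perm (Fin 4), ConfigI (p ∘ σ) → σ = 1}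
  goal := {x |
    (∀ t, x t 1 = x 0 1 ∧ x t 2 = x 0 2) ∧
    CollisionFree x ∧
    ∃ T, (∀ t, T ≤ t → x t = x T) ∧ ConfigII (x 0) (x T)}

end

end Robots

namespace Robots

noncomputable section

/-! Each half of the incomparability rests on one problem.

EqOsc needs simultaneity. If all robots act in every round, the two ends perform the same scaling
about the fixed middle, and the lights alternate the factors `2/3` and `3/2`; connectivity ensures
that each end sees the middle (`algEOSTA_solves`). If robots act one at a time, an end that moves
must keep the distance of the resting other end, so the initial distance never changes and `B'` is
out of reach (`eqOsc_notMem_ssynch`).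

AE needs global information. With full visibility a snapshot is the image of the configuration under
a similarity. Similarities preserve the admissible initial configurations, whose roles are
determined by the point set, so every robot knows its role. Only `A` moves, in one jump to the
mirror image of `D` in the perpendicular bisector of `BC`. The result has a nontrivial symmetry,
hence is never taken for an initial configuration, and everybody rests (`range_ne_symmetrized`,
`mirrorAlgorithm_solves`).

With limited visibility, two initial configurations, a path and a hook, freeze each other. In the
hook `C` sees a single robot and must not move; with suitable frames `A` and `D` of the path and `D`
of the hook have the same view. In the path `C` must not move, and `A` of the hook has its view. By
induction nothing ever moves in either, so the path never becomes Configuration (II)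
(`AE_notMem_limited`). -/

/-! ### Local coordinates and single rounds -/

theorem Frame.toLocal_toGlobal (f : Frame) (w : Plane) : f.toLocal (f.toGlobal w) = w := by
  simp [Frame.toGlobal, Frame.toLocal, smul_smul, mul_inv_cancel₀ f.scale_pos.ne']

theorem Frame.toLocal_smul (f : Frame) (a : ℝ) (v : Plane) :
    f.toLocal (a • v) = a • f.toLocal v := by
  simp only [Frame.toLocal, map_smul, smul_comm f.scale a]

theorem Frame.toLocal_neg (f : Frame) (v : Plane) : f.toLocal (-v) = -f.toLocal v := by
  simp [Frame.toLocal]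

theorem Frame.toLocal_zero (f : Frame) : f.toLocal 0 = 0 := by
  simp [Frame.toLocal]

theorem Frame.toLocal_injective (f : Frame) : Function.Injective f.toLocal :=
  Function.LeftInverse.injective f.toGlobal_toLocal

theorem Frame.toLocal_ne_zero (f : Frame) {v : Plane} (hv : v ≠ 0) : f.toLocal v ≠ 0 := by
  rw [← f.toLocal_zero]
  exact f.toLocal_injective.ne hv

theorem Frame.toGlobal_zero (f : Frame) : f.toGlobal 0 = 0 := by
  simp [Frame.toGlobal]

theorem Frame.toGlobal_eq_zero (f : Frame) {w : Plane} (h : f.toGlobal w = 0) : w = 0 := by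
  rw [← f.toLocal_toGlobal w, h, f.toLocal_zero]

theorem Frame.toGlobal_smul_toLocal (f : Frame) (a : ℝ) (v : Plane) :
    f.toGlobal (a • f.toLocal v) = a • v := by
  rw [← f.toLocal_smul, f.toGlobal_toLocal]

theorem Algorithm.step_of_compute_eq {alg : Algorithm} {n : ℕ} {vis : Visibility}
    {fr : Fin n → Frame} {S : Set (Fin n)} {s : Fin n → Plane × alg.Color} {i : Fin n}
    (hi : i ∈ S) {c : alg.Color} {w : Plane}
    (h : alg.compute (s i).2 (snapshot vis (fr i) (fun j => (s j).1) i) = (c, w)) :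
    alg.step vis fr S s i = ((s i).1 + (fr i).toGlobal w, c) := by
  simp [Algorithm.step, hi, h]

theorem Algorithm.step_of_notMem {alg : Algorithm} {n : ℕ} {vis : Visibility}
    {fr : Fin n → Frame} {S : Set (Fin n)} {s : Fin n → Plane × alg.Color} {i : Fin n}
    (hi : i ∉ S) : alg.step vis fr S s i = s i := by
  simp [Algorithm.step, hi]

/-! ### Oscillation under FSYNCH with limited visibility -/

/-- The color that a moving robot of `algEOSTA` takes. -/
def EOColor.next : EOColor → EOColor
  | .N => .F
  | _ => .N

/-- The factor by which a moving robot of `algEOSTA` changes its distance. -/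
def EOColor.factor : EOColor → ℝ
  | .N => 3 / 2
  | _ => 2 / 3

/-- The far end `2 • v` may or may not be visible, so `S` is only bounded from above. All its points
are nonnegative multiples of `v`: none has its negative in `S` unless it is zero, and `v` is the
only closest one, which determines the choice made by the algorithm. -/
theorem algEOSTA_compute_terminal (c : EOColor) {S : Set Plane} {v : Plane} (hv : v ∈ S)
    (hv0 : v ≠ 0) (hS : ∀ x ∈ S, x = 0 ∨ x = v ∨ x = (2 : ℝ) • v) :
    algEOSTA.compute c S = (c.next, (1 - c.factor) • v) := by
  have h1 : ¬ IsMiddle S := by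
    rintro ⟨x, hx, hx0, hnx⟩
    obtain ⟨a, ha, rfl⟩ : ∃ a : ℝ, 0 < a ∧ x = a • v := by
      rcases hS x hx with h | h | h
      · exact absurd h hx0
      · exact ⟨1, by norm_num, by simp [h]⟩
      · exact ⟨2, by norm_num, h⟩
    obtain ⟨b, hb, hb'⟩ : ∃ b : ℝ, 0 ≤ b ∧ -(a • v) = b • v := by
      rcases hS _ hnx with h | h | h
      · exact ⟨0, le_rfl, by simp [h]⟩
      · exact ⟨1, by norm_num, by simp [h]⟩
      · exact ⟨2, by norm_num, h⟩
    have : (a + b) • v = 0 := by rw [add_smul, ← hb']; simp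
    rcases smul_eq_zero.1 this with h | h
    · linarith
    · exact hv0 h
  have hc : IsClosest S v := by
    refine ⟨hv, hv0, fun w hw hw0 => ?_⟩
    rcases hS w hw with h | h | h
    · exact absurd h hw0
    · rw [h]
    · rw [h, norm_smul]
      norm_num
      linarith [norm_nonneg v]
  have hu : ∀ w, IsClosest S w → w = v := by
    rintro w ⟨hw, hw0, hmin⟩
    rcases hS w hw with h | h | h
    · exact absurd h hw0
    · exact h
    · have := hmin v hv hv0
      rw [h, norm_smul] at this
      norm_num at this
      linarith [norm_pos_iff.2 hv0]
  have h : ¬ IsMiddle S ∧ ∃ v, IsClosest S v := ⟨h1, v, hc⟩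
  have hch : h.2.choose = v := hu _ h.2.choose_spec
  simp only [algEOSTA, dif_pos h, hch]
  cases c <;> simp [EOColor.next, EOColor.factor, sub_smul]

theorem algEOSTA_compute_middle (c : EOColor) {S : Set Plane} (h : IsMiddle S) :
    algEOSTA.compute c S = (c, 0) := by
  have h' : ¬ (¬ IsMiddle S ∧ ∃ v, IsClosest S v) := fun hh => hh.1 h
  simp only [algEOSTA, dif_neg h']

/-- Both terminal robots at distance `a • w` from the middle one, with color `c`. -/
def oscState (A w : Plane) (a : ℝ) (c : EOColor) : Fin 3 → Plane × EOColor :=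
  ![(A + a • w, c), (A, .off), (A - a • w, c)]

/-- The bound `haV` lets each end see the middle and the middle see both ends; whether the ends see
each other is irrelevant. -/
theorem algEOSTA_step (V : ℝ) (fr : Fin 3 → Frame) (A w : Plane) (hw : w ≠ 0) (a : ℝ) (ha : 0 < a)
    (haV : ‖a • w‖ ≤ V) (c : EOColor) :
    algEOSTA.step (.limited V) fr Set.univ (oscState A w a c) =
      oscState A w (c.factor * a) c.next := by
  have haw : a • w ≠ 0 := smul_ne_zero ha.ne' hw
  funext i
  fin_cases i
  · have := algEOSTA_compute_terminal c
      (S := snapshot (.limited V) (fr 0) (fun j => (oscState A w a c j).1) 0)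
      (v := (fr 0).toLocal (-(a • w)))
      ⟨1, by simpa [Visibility.Sees, oscState] using haV, by simp [oscState]⟩
      ((fr 0).toLocal_ne_zero (neg_ne_zero.2 haw))
      (by
        rintro x ⟨j, -, rfl⟩
        fin_cases j
        · left; simp [oscState, Frame.toLocal_zero]
        · right; left; simp [oscState]
        · right; right
          rw [← Frame.toLocal_smul]
          congr 1
          simp [oscState, two_smul]
          abel)
    refine (Algorithm.step_of_compute_eq (i := 0) (Set.mem_univ _) this).trans ?_
    rw [Frame.toGlobal_smul_toLocal]
    refine Prod.ext ?_ rfl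
    change A + a • w + (1 - c.factor) • -(a • w) = A + (c.factor * a) • w
    module
  · have := algEOSTA_compute_middle .off
      (S := snapshot (.limited V) (fr 1) (fun j => (oscState A w a c j).1) 1)
      ⟨(fr 1).toLocal (a • w), ⟨0, by simpa [Visibility.Sees, oscState] using haV,
          by simp [oscState]⟩, (fr 1).toLocal_ne_zero haw,
        ⟨2, by simpa [Visibility.Sees, oscState] using haV,
          by simp [oscState, Frame.toLocal_neg]⟩⟩
    refine (Algorithm.step_of_compute_eq (i := 1) (Set.mem_univ _) this).trans ?_
    rw [Frame.toGlobal_zero, add_zero]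
    rfl
  · have := algEOSTA_compute_terminal c
      (S := snapshot (.limited V) (fr 2) (fun j => (oscState A w a c j).1) 2)
      (v := (fr 2).toLocal (a • w))
      ⟨1, by simpa [Visibility.Sees, oscState] using haV, by simp [oscState]⟩
      ((fr 2).toLocal_ne_zero haw)
      (by
        rintro x ⟨j, -, rfl⟩
        fin_cases j
        · right; right
          rw [← Frame.toLocal_smul]
          congr 1
          simp [oscState, two_smul]
        · right; left; simp [oscState]
        · left; simp [oscState, Frame.toLocal_zero])
    refine (Algorithm.step_of_compute_eq (i := 2) (Set.mem_univ _) this).trans ?_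
    rw [Frame.toGlobal_smul_toLocal]
    refine Prod.ext ?_ rfl
    change A - a • w + (1 - c.factor) • a • w = A - (c.factor * a) • w
    module

theorem algEOSTA_solves (V : ℝ) (R : Team 3) : Solves algEOSTA .fsynch (.limited V) R EqOsc := by
  rintro fr - p ⟨hp, hmid⟩ hconn act hact
  have hact' : ∀ t, act t = Set.univ := hact
  set A := p 1 with hA
  set w := p 0 - p 1 with hwdef
  have hp0 : p 0 = A + (1 : ℝ) • w := by simp [hwdef, hA]
  have hp2 : p 2 = A - (1 : ℝ) • w := by
    have : A = (2 : ℝ)⁻¹ • (p 0 + p 2) := by rw [hmid, midpoint_eq_smul_add]; simp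
    have h2 : p 0 + p 2 = (2 : ℝ) • A := by rw [this, smul_smul]; simp
    rw [one_smul, hwdef, eq_sub_of_add_eq' h2]
    module
  have hw : w ≠ 0 := by
    intro h
    apply hp
    rw [hp0, hp2, h]
    simp
  -- The middle robot has a neighbour in the connected graph, and both candidates are at distance
  -- `‖w‖`.
  have hV : ‖w‖ ≤ V := by
    obtain ⟨j, hj⟩ := hconn.preconnected.exists_adj_of_nontrivial 1
    simp only [visibilityGraph, SimpleGraph.fromRel_adj, Visibility.Sees] at hj
    obtain ⟨hne, h⟩ := hj
    rw [dist_comm (p j), or_self] at h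
    fin_cases j
    · simpa [hp0, dist_eq_norm, ← hA] using h
    · exact absurd rfl hne
    · simpa [hp2, dist_eq_norm, ← hA] using h
  -- Since `3/2 * (2/3) = 1`, the motion has period two, except that the light is off instead of `F`
  -- in round `0`; both colors act alike.
  have key : ∀ k, algEOSTA.state (.limited V) fr act p (2 * k) =
        oscState A w 1 (if k = 0 then .off else .F) ∧
      algEOSTA.state (.limited V) fr act p (2 * k + 1) = oscState A w (2 / 3) .N := by
    have hodd : ∀ k, algEOSTA.state (.limited V) fr act p (2 * k) =
        oscState A w 1 (if k = 0 then .off else .F) →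
        algEOSTA.state (.limited V) fr act p (2 * k + 1) = oscState A w (2 / 3) .N := by
      intro k h
      rw [Algorithm.state, hact', h, algEOSTA_step V fr A w hw 1 one_pos (by simpa using hV)]
      split_ifs <;> simp only [EOColor.factor, EOColor.next, mul_one] <;> rfl
    intro k
    induction k with
    | zero =>
      have h0 : algEOSTA.state (.limited V) fr act p (2 * 0) =
          oscState A w 1 (if 0 = 0 then .off else .F) := by
        funext i
        fin_cases i
        · exact Prod.ext hp0 rfl
        · rfl
        · exact Prod.ext hp2 rfl
      exact ⟨h0, hodd 0 h0⟩
    | succ k ih =>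
      have h0 : algEOSTA.state (.limited V) fr act p (2 * (k + 1)) =
          oscState A w 1 (if k + 1 = 0 then .off else .F) := by
        rw [show 2 * (k + 1) = (2 * k + 1) + 1 by ring, Algorithm.state, hact', ih.2,
          algEOSTA_step V fr A w hw (2 / 3) (by norm_num) (by
            rw [norm_smul]
            norm_num
            linarith [norm_nonneg w])]
        norm_num [EOColor.factor, EOColor.next]
        rfl
      exact ⟨h0, hodd (k + 1) h0⟩
  have heven : ∀ k, algEOSTA.run (.limited V) fr act p (2 * k) =
      ![A + (1 : ℝ) • w, A, A - (1 : ℝ) • w] := by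
    intro k
    funext i
    unfold Algorithm.run
    rw [(key k).1]
    fin_cases i <;> rfl
  have hodd : ∀ k, algEOSTA.run (.limited V) fr act p (2 * k + 1) =
      ![A + (2 / 3 : ℝ) • w, A, A - (2 / 3 : ℝ) • w] := by
    intro k
    funext i
    unfold Algorithm.run
    rw [(key k).2]
    fin_cases i <;> rfl
  have hinit := heven 0
  rw [Nat.mul_zero] at hinit
  have hne : A + (1 : ℝ) • w ≠ A + (2 / 3 : ℝ) • w := by
    intro h
    have : (1 / 3 : ℝ) • w = 0 := by
      rw [← sub_eq_zero.2 h]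
      module
    rcases smul_eq_zero.1 this with h | h
    · norm_num at h
    · exact hw h
  have hB' : AffineMap.lineMap A (A + (1 : ℝ) • w) (2 / 3 : ℝ) = A + (2 / 3 : ℝ) • w := by
    simp [AffineMap.lineMap_apply, add_comm]
  have hC' : AffineMap.lineMap A (A - (1 : ℝ) • w) (2 / 3 : ℝ) = A - (2 / 3 : ℝ) • w := by
    simp [AffineMap.lineMap_apply]
    abel
  simp only [EqOsc, Set.mem_ofPred_eq, hinit, Matrix.cons_val, hB', hC']
  refine ⟨fun t => ?_, fun t => ?_, fun t ht => ?_, fun t ht => ?_⟩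
  · rcases Nat.even_or_odd' t with ⟨k, rfl | rfl⟩
    · simp [heven]
    · simp [hodd]
  · rcases Nat.even_or_odd' t with ⟨k, rfl | rfl⟩
    · simp [heven, dist_eq_norm]
    · simp [hodd, dist_eq_norm]
  · rcases Nat.even_or_odd' t with ⟨k, rfl | rfl⟩
    · exact ⟨2 * k + 1, by omega, by simp [hodd], by simp [hodd]⟩
    · exact absurd ht.1.symm (by simpa [hodd] using hne)
  · rcases Nat.even_or_odd' t with ⟨k, rfl | rfl⟩
    · exact absurd ht.1 (by simpa [heven] using hne)
    · exact ⟨2 * (k + 1), by omega, by simp [heven], by simp [heven]⟩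

/-! ### EqOsc is unsolvable when robots act one at a time -/

/-- One robot per round, in turn. -/
def roundRobin (t : ℕ) : Set (Fin 3) := {Fin.ofNat 3 t}

theorem roundRobin_admits : Scheduler.ssynch.Admits roundRobin := by
  -- Round `3 * t + i` is not before `t` and is congruent to `i` modulo `3`.
  refine ⟨fun t => Set.singleton_nonempty _, fun i t => ⟨3 * t + i, by omega, ?_⟩⟩
  simp [roundRobin, Fin.ofNat, Nat.mod_eq_of_lt i.2]

theorem eqOsc_notMem_ssynch (R : Team 3) : EqOsc ∉ Task .ssynch .full R := by
  rintro ⟨alg, hsolve⟩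
  obtain ⟨fr, hfr⟩ := R.frames_nonempty
  let e : Plane := EuclideanSpace.single 0 1
  have he : ‖e‖ = 1 := by simp [e]
  have he0 : e ≠ 0 := by rw [← norm_pos_iff, he]; exact one_pos
  let p : Config 3 := ![e, 0, -e]
  have hp : p ∈ EqOsc.init := by
    refine ⟨?_, ?_⟩
    · intro h
      have h2 : (2 : ℝ) • e = 0 := by
        rw [two_smul]
        exact add_eq_zero_iff_eq_neg.2 h
      exact he0 ((smul_eq_zero.1 h2).resolve_left two_ne_zero)
    · simp [p, midpoint_eq_smul_add]
  have hconn : (visibilityGraph .full p).Connected := by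
    have : visibilityGraph .full p = ⊤ := by
      ext i j
      simp [visibilityGraph, Visibility.Sees]
    rw [this]
    exact SimpleGraph.connected_top
  obtain ⟨h1, h2, h3, -⟩ := hsolve fr hfr p hp hconn roundRobin roundRobin_admits
  set x := alg.run .full fr roundRobin p with hx
  have hstay : ∀ t i, i ∉ roundRobin t → x (t + 1) i = x t i := by
    intro t i hi
    simp only [hx, Algorithm.run, Algorithm.state]
    rw [Algorithm.step_of_notMem hi]
  have hx0 : x 0 = p := rfl
  -- Only the distance is invariant, not the position: an end could still turn about `A`. When robot
  -- `0` acts, robot `2` rests and equidistance transfers its old distance.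
  have hd : ∀ t, dist (x t 0) (x t 1) = 1 := by
    intro t
    induction t with
    | zero => simp [hx0, p, he]
    | succ t ih =>
      by_cases h0 : (0 : Fin 3) ∈ roundRobin t
      · have h20 : (2 : Fin 3) ∉ roundRobin t := by
          simp only [roundRobin, Set.mem_singleton_iff] at h0 ⊢
          rw [← h0]
          decide
        rw [h2, hstay t 2 h20, h1, ← h1 t, ← h2, ih]
      · rw [hstay t 0 h0, h1, ← h1 t, ih]
  obtain ⟨t, -, ht, -⟩ := h3 0 ⟨rfl, rfl⟩
  have := hd t
  rw [h1, ht] at this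
  simp [hx0, p, AffineMap.lineMap_apply, norm_smul, he] at this
  norm_num at this

/-! ### Configuration (I): inner products and invariance under similarities -/

/-- Cosine is strictly decreasing on `[0, π]`, and for acute angles both cosines are positive, so
they can be compared after cross-multiplying and squaring. The result is free of roots and becomes
decidable at integer points. -/
theorem angle_lt_and_lt_pi_div_two_iff {x y x' y' : Plane} :
    (InnerProductGeometry.angle x y < InnerProductGeometry.angle x' y' ∧
      InnerProductGeometry.angle x' y' < Real.pi / 2) ↔
    0 < inner ℝ x y ∧ 0 < inner ℝ x' y' ∧
      inner ℝ x' y' ^ 2 * (inner ℝ x x * inner ℝ y y) <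
        inner ℝ x y ^ 2 * (inner ℝ x' x' * inner ℝ y' y') := by
  have hpos : ∀ {u v : Plane}, 0 < inner ℝ u v → 0 < ‖u‖ * ‖v‖ := fun h =>
    lt_of_lt_of_le h (real_inner_le_norm _ _)
  -- Zero vectors cause no exception: their angle is `π / 2` by convention and their inner product
  -- is `0`.
  have hlt : ∀ {u v : Plane}, InnerProductGeometry.angle u v < Real.pi / 2 ↔ 0 < inner ℝ u v := by
    intro u v
    rw [InnerProductGeometry.angle, Real.arccos_lt_pi_div_two]
    constructor
    · intro h
      by_contra hc
      exact absurd h (not_lt.2 (div_nonpos_of_nonpos_of_nonneg (not_lt.1 hc) (by positivity)))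
    · exact fun h => div_pos h (hpos h)
  have hsq : ∀ {u v u' v' : Plane}, 0 < inner ℝ u v → 0 < inner ℝ u' v' →
      (InnerProductGeometry.angle u v < InnerProductGeometry.angle u' v' ↔
      inner ℝ u' v' ^ 2 * (inner ℝ u u * inner ℝ v v) <
        inner ℝ u v ^ 2 * (inner ℝ u' u' * inner ℝ v' v')) := by
    intro u v u' v' h h'
    have e1 : InnerProductGeometry.angle u v < InnerProductGeometry.angle u' v' ↔
        Real.cos (InnerProductGeometry.angle u' v') < Real.cos (InnerProductGeometry.angle u v) :=
      (Real.strictAntiOn_cos.lt_iff_gt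
        ⟨InnerProductGeometry.angle_nonneg _ _, InnerProductGeometry.angle_le_pi _ _⟩
        ⟨InnerProductGeometry.angle_nonneg _ _, InnerProductGeometry.angle_le_pi _ _⟩).symm
    rw [e1, InnerProductGeometry.cos_angle, InnerProductGeometry.cos_angle,
      div_lt_div_iff₀ (hpos h') (hpos h),
      ← pow_lt_pow_iff_left₀ (mul_nonneg h'.le (hpos h).le) (mul_nonneg h.le (hpos h').le)
        two_ne_zero]
    simp only [real_inner_self_eq_norm_sq, mul_pow]
  constructor
  · rintro ⟨h1, h2⟩
    have h3 := hlt.1 h2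
    have h4 := hlt.1 (h1.trans h2)
    exact ⟨h4, h3, (hsq h4 h3).1 h1⟩
  · rintro ⟨h4, h3, h⟩
    exact ⟨(hsq h4 h3).2 h, hlt.2 h3⟩

/-- The angle conditions of a Configuration (I), in terms of inner products. -/
theorem configI_iff {p : Config 4} :
    ConfigI p ↔ SameSide (p 1) (p 2) (p 0) (p 3) ∧
      0 < inner ℝ (p 0 - p 1) (p 1 - p 2) ∧ 0 < inner ℝ (p 3 - p 2) (p 2 - p 1) ∧
      inner ℝ (p 3 - p 2) (p 2 - p 1) ^ 2 *
          (inner ℝ (p 0 - p 1) (p 0 - p 1) * inner ℝ (p 1 - p 2) (p 1 - p 2)) <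
        inner ℝ (p 0 - p 1) (p 1 - p 2) ^ 2 *
          (inner ℝ (p 3 - p 2) (p 3 - p 2) * inner ℝ (p 2 - p 1) (p 2 - p 1)) := by
  rw [ConfigI, outerAngle, outerAngle, angle_lt_and_lt_pi_div_two_iff]

theorem sameSide_of_eq {Q R P P' : Plane} (hP : ∀ r : ℝ, P - Q ≠ r • (R - Q)) {t r : ℝ}
    (ht : 0 < t) (h : P' - Q = t • (P - Q) + r • (R - Q)) : SameSide Q R P P' := by
  have hn : P ∉ affineSpan ℝ {Q, R} := by
    intro hm
    obtain ⟨r, hr⟩ := (vadd_left_mem_affineSpan_pair (k := ℝ) (p₁ := Q) (p₂ := R)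
      (v := P - Q)).1 (by simpa using hm)
    exact hP r hr.symm
  have h' : P' = t • (P -ᵥ Q) +ᵥ AffineMap.lineMap Q R r := by
    rw [sub_eq_iff_eq_add.1 h]
    simp [AffineMap.lineMap_apply, add_assoc]
  rw [SameSide, h']
  exact (AffineSubspace.sSameSide_smul_vsub_vadd_left hn (left_mem_affineSpan_pair ℝ Q R)
    (AffineMap.lineMap_mem_affineSpan_pair r Q R) ht).symm

/-- An affine equivalence that preserves angles. -/
def IsConformal (g : Plane ≃ᵃ[ℝ] Plane) : Prop :=
  ∀ u v, InnerProductGeometry.angle (g.linear u) (g.linear v) = InnerProductGeometry.angle u v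

theorem IsConformal.outerAngle {g : Plane ≃ᵃ[ℝ] Plane} (hg : IsConformal g) (P Q R : Plane) :
    outerAngle (g P) (g Q) (g R) = Robots.outerAngle P Q R := by
  have h : ∀ x y, g x - g y = g.linear (x - y) := fun x y => (g.toAffineMap.linearMap_vsub x y).symm
  rw [Robots.outerAngle, h, h, hg, Robots.outerAngle]

theorem sameSide_map_iff (g : Plane ≃ᵃ[ℝ] Plane) (Q R P P' : Plane) :
    SameSide (g Q) (g R) (g P) (g P') ↔ SameSide Q R P P' := by
  have h : affineSpan ℝ {g Q, g R} = (affineSpan ℝ {Q, R}).map (g : Plane →ᵃ[ℝ] Plane) := by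
    rw [AffineSubspace.map_span, Set.image_pair]
    rfl
  rw [SameSide, h]
  exact g.sSameSide_map_iff

theorem IsConformal.configI_iff {g : Plane ≃ᵃ[ℝ] Plane} (hg : IsConformal g) (p : Config 4) :
    ConfigI (fun i => g (p i)) ↔ ConfigI p := by
  simp only [ConfigI, sameSide_map_iff, hg.outerAngle]

theorem mem_AE_init {p : Config 4} :
    p ∈ AE.init ↔ ConfigI p ∧ ∀ σ : Equiv.Perm (Fin 4), ConfigI (p ∘ σ) → σ = 1 :=
  Iff.rfl

theorem IsConformal.mem_init_iff {g : Plane ≃ᵃ[ℝ] Plane} (hg : IsConformal g) (p : Config 4) :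
    (fun i => g (p i)) ∈ AE.init ↔ p ∈ AE.init := by
  simp only [mem_AE_init, hg.configI_iff]
  refine and_congr_right fun _ => forall_congr' fun σ => ?_
  rw [← hg.configI_iff (p ∘ σ)]
  rfl

/-- The homothety with center `0` and ratio `k`. -/
def dilation (k : ℝ) (hk : k ≠ 0) : Plane ≃ᵃ[ℝ] Plane :=
  (LinearEquiv.smulOfNeZero ℝ Plane k hk).toAffineEquiv

theorem isConformal_dilation (k : ℝ) (hk : k ≠ 0) : IsConformal (dilation k hk) := fun u v =>
  InnerProductGeometry.angle_smul_smul hk u v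

/-! ### Two explicit integer configurations -/

/-- The configuration with given integer coordinates. -/
def gridConfig (X Y : Fin 4 → ℤ) : Config 4 := fun i => !₂[(X i : ℝ), (Y i : ℝ)]

/-- Integer version of `inner ℝ (P - Q) (P' - Q')` for points of a grid configuration. -/
def gridInner (X Y : Fin 4 → ℤ) (i j k l : Fin 4) : ℤ :=
  (X i - X j) * (X k - X l) + (Y i - Y j) * (Y k - Y l)

theorem inner_gridConfig (X Y : Fin 4 → ℤ) (i j k l : Fin 4) :
    inner ℝ (gridConfig X Y i - gridConfig X Y j) (gridConfig X Y k - gridConfig X Y l) =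
      gridInner X Y i j k l := by
  simp [gridConfig, gridInner, PiLp.inner_apply, Fin.sum_univ_two]
  ring

theorem dist_gridConfig_sq (X Y : Fin 4 → ℤ) (i j : Fin 4) :
    dist (gridConfig X Y i) (gridConfig X Y j) ^ 2 = gridInner X Y i j i j := by
  rw [dist_eq_norm, ← real_inner_self_eq_norm_sq, inner_gridConfig]

/-- The angle conditions of a Configuration (I) for a labelling of a grid configuration. -/
abbrev GridAngles (X Y : Fin 4 → ℤ) (σ : Fin 4 → Fin 4) : Prop :=
  0 < gridInner X Y (σ 0) (σ 1) (σ 1) (σ 2) ∧ 0 < gridInner X Y (σ 3) (σ 2) (σ 2) (σ 1) ∧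
    gridInner X Y (σ 3) (σ 2) (σ 2) (σ 1) ^ 2 *
        (gridInner X Y (σ 0) (σ 1) (σ 0) (σ 1) * gridInner X Y (σ 1) (σ 2) (σ 1) (σ 2)) <
      gridInner X Y (σ 0) (σ 1) (σ 1) (σ 2) ^ 2 *
        (gridInner X Y (σ 3) (σ 2) (σ 3) (σ 2) * gridInner X Y (σ 2) (σ 1) (σ 2) (σ 1))

theorem configI_gridConfig_comp_iff (X Y : Fin 4 → ℤ) (σ : Fin 4 → Fin 4) :
    ConfigI (gridConfig X Y ∘ σ) ↔
      SameSide (gridConfig X Y (σ 1)) (gridConfig X Y (σ 2)) (gridConfig X Y (σ 0))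
        (gridConfig X Y (σ 3)) ∧ GridAngles X Y σ := by
  rw [configI_iff]
  simp only [Function.comp_apply, inner_gridConfig, GridAngles]
  norm_cast

/-- The angle inequalities alone exclude all other labellings, so the side condition is needed only
for the given one, and the 24 permutations can be checked by `decide`. -/
theorem gridConfig_mem_init {X Y : Fin 4 → ℤ}
    (hs : SameSide (gridConfig X Y 1) (gridConfig X Y 2) (gridConfig X Y 0) (gridConfig X Y 3))
    (h : ∀ σ : Equiv.Perm (Fin 4), GridAngles X Y σ ↔ σ = 1) : gridConfig X Y ∈ AE.init := by
  refine ⟨?_, fun σ hσ => ?_⟩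
  · exact (configI_gridConfig_comp_iff X Y id).2 ⟨hs, (h 1).2 rfl⟩
  · exact (h σ).1 ((configI_gridConfig_comp_iff X Y σ).1 hσ).2

/-- Robots `3`, `2`, `1`, `0` form a path along which they see each other. -/
def pathX : Fin 4 → ℤ := ![56, 50, 0, -14]
def pathY : Fin 4 → ℤ := ![8, 0, 0, 48]

/-- Robots `3`, `0`, `1`, `2` form a path along which they see each other. -/
def hookX : Fin 4 → ℤ := ![0, 50, 57, -14]
def hookY : Fin 4 → ℤ := ![0, 0, 24, 48]

theorem path_mem_init : gridConfig pathX pathY ∈ AE.init := by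
  refine gridConfig_mem_init (sameSide_of_eq (t := 6) (r := 2) (fun r h => ?_) (by norm_num) ?_)
    (by decide)
  · have h0 := congrArg (fun v : Plane => v 1) h
    simp [gridConfig, pathY] at h0
  · ext i
    fin_cases i <;> simp [gridConfig, pathX, pathY] <;> norm_num

theorem hook_mem_init : gridConfig hookX hookY ∈ AE.init := by
  refine gridConfig_mem_init (sameSide_of_eq (t := 39 / 25) (r := 2) (fun r h => ?_)
    (by norm_num) ?_) (by decide)
  · have h0 := congrArg (fun v : Plane => v 0) h
    have h1 := congrArg (fun v : Plane => v 1) h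
    simp [gridConfig, hookX, hookY] at h0 h1
    simp [h1] at h0
  · ext i
    fin_cases i <;> simp [gridConfig, hookX, hookY] <;> norm_num

/-! ### AE is unsolvable with limited visibility -/

/-- Scaling makes the lengths equal, and a reflection exchanges two vectors of equal length. This
gives all robots with a single visible neighbour the same snapshot. -/
theorem exists_frame_toLocal_eq {u v : Plane} (hu : u ≠ 0) (hv : v ≠ 0) :
    ∃ f : Frame, f.toLocal v = u := by
  have hu' := norm_pos_iff.2 hu
  have hv' := norm_pos_iff.2 hv
  refine ⟨⟨‖u‖ / ‖v‖, by positivity, (ℝ ∙ ((‖u‖ / ‖v‖) • v - u))ᗮ.reflection⟩, ?_⟩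
  rw [Frame.toLocal, ← map_smul]
  apply Submodule.reflection_sub
  rw [norm_smul, norm_div, norm_norm, norm_norm, div_mul_cancel₀ _ hv'.ne']

theorem snapshot_eq_pair {n : ℕ} {vis : Visibility} {f : Frame} {p : Config n} {i j : Fin n}
    (h : ∀ l, vis.Sees (p i) (p l) ↔ l = i ∨ l = j) :
    snapshot vis f p i = {0, f.toLocal (p j - p i)} := by
  ext w
  simp [snapshot, h, or_and_right, exists_or, Frame.toLocal_zero]

theorem snapshot_eq_triple {n : ℕ} {vis : Visibility} {f : Frame} {p : Config n} {i j k : Fin n}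
    (h : ∀ l, vis.Sees (p i) (p l) ↔ l = i ∨ l = j ∨ l = k) :
    snapshot vis f p i = {0, f.toLocal (p j - p i), f.toLocal (p k - p i)} := by
  ext w
  simp [snapshot, h, or_and_right, exists_or, Frame.toLocal_zero]

/-- A grid configuration, scaled such that robots see each other up to distance `50`. -/
def scaledGrid (V : ℝ) (X Y : Fin 4 → ℤ) : Config 4 := fun i => (V / 50) • gridConfig X Y i

theorem sees_scaledGrid {V : ℝ} (hV : 0 < V) (X Y : Fin 4 → ℤ) (i j : Fin 4) :
    (Visibility.limited V).Sees (scaledGrid V X Y i) (scaledGrid V X Y j) ↔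
      gridInner X Y i j i j ≤ 2500 := by
  have h : dist (scaledGrid V X Y i) (scaledGrid V X Y j) =
      V / 50 * dist (gridConfig X Y i) (gridConfig X Y j) := by
    rw [scaledGrid, scaledGrid, dist_smul₀, Real.norm_of_nonneg (by positivity)]
  have h2 : gridInner X Y i j i j ≤ 2500 ↔
      dist (gridConfig X Y i) (gridConfig X Y j) ^ 2 ≤ 50 ^ 2 := by
    rw [dist_gridConfig_sq, ← @Int.cast_le ℝ]
    norm_num
  rw [Visibility.Sees, h, h2, pow_le_pow_iff_left₀ dist_nonneg (by norm_num) two_ne_zero]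
  constructor <;> intro h
  · by_contra hc
    nlinarith
  · nlinarith

theorem scaledGrid_mem_init {V : ℝ} (hV : 0 < V) {X Y : Fin 4 → ℤ}
    (h : gridConfig X Y ∈ AE.init) : scaledGrid V X Y ∈ AE.init :=
  ((isConformal_dilation (V / 50) (by positivity)).mem_init_iff _).2 h

theorem scaledGrid_adj {V : ℝ} (hV : 0 < V) {X Y : Fin 4 → ℤ} {i j : Fin 4} (hne : i ≠ j)
    (h : gridInner X Y i j i j ≤ 2500) :
    (visibilityGraph (.limited V) (scaledGrid V X Y)).Reachable i j := by
  apply SimpleGraph.Adj.reachable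
  rw [visibilityGraph, SimpleGraph.fromRel_adj]
  exact ⟨hne, Or.inl ((sees_scaledGrid hV X Y i j).2 h)⟩

theorem path_connected {V : ℝ} (hV : 0 < V) :
    (visibilityGraph (.limited V) (scaledGrid V pathX pathY)).Connected := by
  have h01 := scaledGrid_adj hV (X := pathX) (Y := pathY) (i := 1) (j := 0) (by decide) (by decide)
  have h12 := scaledGrid_adj hV (X := pathX) (Y := pathY) (i := 1) (j := 2) (by decide) (by decide)
  have h23 := scaledGrid_adj hV (X := pathX) (Y := pathY) (i := 2) (j := 3) (by decide) (by decide)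
  rw [SimpleGraph.connected_iff_exists_forall_reachable]
  refine ⟨1, fun w => ?_⟩
  fin_cases w
  exacts [h01, SimpleGraph.Reachable.refl _, h12, h12.trans h23]

theorem hook_connected {V : ℝ} (hV : 0 < V) :
    (visibilityGraph (.limited V) (scaledGrid V hookX hookY)).Connected := by
  have h01 := scaledGrid_adj hV (X := hookX) (Y := hookY) (i := 1) (j := 0) (by decide) (by decide)
  have h12 := scaledGrid_adj hV (X := hookX) (Y := hookY) (i := 1) (j := 2) (by decide) (by decide)
  have h03 := scaledGrid_adj hV (X := hookX) (Y := hookY) (i := 0) (j := 3) (by decide) (by decide)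
  rw [SimpleGraph.connected_iff_exists_forall_reachable]
  refine ⟨1, fun w => ?_⟩
  fin_cases w
  exacts [h01, SimpleGraph.Reachable.refl _, h12, h01.trans h03]

/-- The team without any agreement on coordinate systems. -/
def disorientedTeam (n : ℕ) : Team n where
  frames := Set.univ
  frames_nonempty := ⟨fun _ => ⟨1, one_pos, .refl ℝ _⟩, trivial⟩

theorem AE_notMem_limited {V : ℝ} (hV : 0 < V) :
    AE ∉ Task .fsynch (.limited V) (disorientedTeam 4) := by
  rintro ⟨alg, hsolve⟩
  set p := scaledGrid V pathX pathY with hp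
  set q := scaledGrid V hookX hookY with hq
  have hseesP : ∀ i j, (Visibility.limited V).Sees (p i) (p j) ↔
    gridInner pathX pathY i j i j ≤ 2500 := sees_scaledGrid hV _ _
  have hseesQ : ∀ i j, (Visibility.limited V).Sees (q i) (q j) ↔
    gridInner hookX hookY i j i j ≤ 2500 := sees_scaledGrid hV _ _
  let u : Plane := EuclideanSpace.single 0 1
  have hu : u ≠ 0 := by simp [u]
  -- An arbitrary frame for `v = 0` makes `F` total. Only its value `F 0` as a common frame of robot
  -- `2` in the path and robot `0` in the hook matters later.
  have hframe : ∀ v : Plane, ∃ f : Frame, v ≠ 0 → f.toLocal v = u := fun v => by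
    by_cases hv : v = 0
    · exact ⟨⟨1, one_pos, .refl ℝ _⟩, fun h => absurd hv h⟩
    · exact (exists_frame_toLocal_eq hu hv).imp fun f hf _ => hf
  choose F hF using hframe
  have hne : ∀ {X Y : Fin 4 → ℤ} {i j : Fin 4}, gridInner X Y j i j i ≠ 0 →
      scaledGrid V X Y j - scaledGrid V X Y i ≠ 0 := by
    intro X Y i j h h0
    rw [scaledGrid, scaledGrid, ← smul_sub, smul_eq_zero] at h0
    apply h
    rw [← @Int.cast_eq_zero ℝ, ← inner_gridConfig, h0.resolve_left (by positivity),
      inner_zero_left]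
  let fp : Fin 4 → Frame := ![F (p 1 - p 0), F 0, F 0, F (p 2 - p 3)]
  let fq : Fin 4 → Frame := ![F 0, F 0, F (q 1 - q 2), F (q 0 - q 3)]
  have sp0 : snapshot (.limited V) (fp 0) p 0 = {0, u} := by
    rw [snapshot_eq_pair (j := 1) (fun l => (hseesP 0 l).trans (by revert l; decide))]
    simp only [fp, Matrix.cons_val]
    rw [hF _ (hne (by decide))]
  have sp3 : snapshot (.limited V) (fp 3) p 3 = {0, u} := by
    rw [snapshot_eq_pair (j := 2) (fun l => (hseesP 3 l).trans (by revert l; decide))]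
    simp only [fp, Matrix.cons_val]
    rw [hF _ (hne (by decide))]
  have sq2 : snapshot (.limited V) (fq 2) q 2 = {0, u} := by
    rw [snapshot_eq_pair (j := 1) (fun l => (hseesQ 2 l).trans (by revert l; decide))]
    simp only [fq, Matrix.cons_val]
    rw [hF _ (hne (by decide))]
  have sq3 : snapshot (.limited V) (fq 3) q 3 = {0, u} := by
    rw [snapshot_eq_pair (j := 0) (fun l => (hseesQ 3 l).trans (by revert l; decide))]
    simp only [fq, Matrix.cons_val]
    rw [hF _ (hne (by decide))]
  have spq : snapshot (.limited V) (fq 0) q 0 = snapshot (.limited V) (fp 2) p 2 := by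
    rw [snapshot_eq_triple (i := 0) (j := 1) (k := 3)
        (fun l => (hseesQ 0 l).trans (by revert l; decide)),
      snapshot_eq_triple (i := 2) (j := 1) (k := 3)
        (fun l => (hseesP 2 l).trans (by revert l; decide))]
    -- Both robots stand at the origin and see points at `(50, 0)` and `(-14, 48)`, up to the factor
    -- `V / 50`.
    simp [fp, fq, p, q, scaledGrid, gridConfig, pathX, pathY, hookX, hookY]
  obtain ⟨hP, -, T, -, -, -, hT1, hT2⟩ := hsolve fp trivial p
    (scaledGrid_mem_init hV path_mem_init) (path_connected hV) (fun _ => Set.univ) (fun _ => rfl)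
  obtain ⟨hQ, -⟩ := hsolve fq trivial q
    (scaledGrid_mem_init hV hook_mem_init) (hook_connected hV) (fun _ => Set.univ) (fun _ => rfl)
  set s := alg.state (.limited V) fp (fun _ => Set.univ) p with hs
  set r := alg.state (.limited V) fq (fun _ => Set.univ) q with hr
  have hs1 : ∀ t i, s (t + 1) i = ((s t i).1 + (fp i).toGlobal (alg.compute (s t i).2
      (snapshot (.limited V) (fp i) (fun j => (s t j).1) i)).2, (alg.compute (s t i).2
      (snapshot (.limited V) (fp i) (fun j => (s t j).1) i)).1) := fun t i =>
    Algorithm.step_of_compute_eq (Set.mem_univ i) rfl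
  have hr1 : ∀ t i, r (t + 1) i = ((r t i).1 + (fq i).toGlobal (alg.compute (r t i).2
      (snapshot (.limited V) (fq i) (fun j => (r t j).1) i)).2, (alg.compute (r t i).2
      (snapshot (.limited V) (fq i) (fun j => (r t j).1) i)).1) := fun t i =>
    Algorithm.step_of_compute_eq (Set.mem_univ i) rfl
  have hP1 : ∀ t, (s t 1).1 = p 1 := fun t => (hP t).1
  have hP2 : ∀ t, (s t 2).1 = p 2 := fun t => (hP t).2
  have hQ1 : ∀ t, (r t 1).1 = q 1 := fun t => (hQ t).1
  have hQ2 : ∀ t, (r t 2).1 = q 2 := fun t => (hQ t).2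
  -- Equal views preserve equal lights, so the two runs stay coupled: one color is shared by all
  -- robots with a single neighbour, another by the two robots at the origin.
  have key : ∀ t, (fun j => (s t j).1) = p ∧ (fun j => (r t j).1) = q ∧
      (s t 0).2 = (r t 2).2 ∧ (s t 3).2 = (r t 2).2 ∧ (r t 3).2 = (r t 2).2 ∧
      (r t 0).2 = (s t 2).2 := by
    intro t
    induction t with
    | zero => exact ⟨rfl, rfl, rfl, rfl, rfl, rfl⟩
    | succ t ih =>
      obtain ⟨ip, iq, c1, c2, c3, c4⟩ := ih
      -- Robot `2` of the hook is forbidden to move, which reveals the decision of every robot with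
      -- the view `{0, u}`; robot `2` of the path does the same for the view with two neighbours.
      have hleaf : (alg.compute (r t 2).2 {0, u}).2 = 0 := by
        have h := hQ2 (t + 1)
        rw [hr1, iq, sq2, hQ2 t] at h
        exact Frame.toGlobal_eq_zero _ (add_eq_left.1 h)
      have hinner : (alg.compute (s t 2).2 (snapshot (.limited V) (fp 2) p 2)).2 = 0 := by
        have h := hP2 (t + 1)
        rw [hs1, ip, hP2 t] at h
        exact Frame.toGlobal_eq_zero _ (add_eq_left.1 h)
      have hp' : ∀ j, (s t j).1 = p j := congrFun ip
      have hq' : ∀ j, (r t j).1 = q j := congrFun iq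
      refine ⟨?_, ?_, ?_, ?_, ?_, ?_⟩
      · funext j
        fin_cases j
        · change (s (t + 1) 0).1 = p 0
          rw [hs1, ip, sp0, c1, hleaf, Frame.toGlobal_zero, add_zero, hp']
        · exact hP1 _
        · exact hP2 _
        · change (s (t + 1) 3).1 = p 3
          rw [hs1, ip, sp3, c2, hleaf, Frame.toGlobal_zero, add_zero, hp']
      · funext j
        fin_cases j
        · change (r (t + 1) 0).1 = q 0
          rw [hr1, iq, spq, c4, hinner, Frame.toGlobal_zero, add_zero, hq']
        · exact hQ1 _
        · exact hQ2 _
        · change (r (t + 1) 3).1 = q 3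
          rw [hr1, iq, sq3, c3, hleaf, Frame.toGlobal_zero, add_zero, hq']
      · rw [hs1, hr1, ip, iq, sp0, sq2, c1]
      · rw [hs1, hr1, ip, iq, sp3, sq2, c2]
      · rw [hr1, hr1, iq, sq3, sq2, c3]
      · rw [hs1, hr1, ip, iq, spq, c4]
  have hT0 : alg.run (.limited V) fp (fun _ => Set.univ) p T = p := (key T).1
  rw [hT0] at hT1
  -- The path has not changed, so the two angles are still different.
  exact absurd hT1 (scaledGrid_mem_init hV path_mem_init).1.2.1.ne

/-! ### The mirror image and local coordinates -/

theorem isConformal_of_isometry {g : Plane ≃ᵃ[ℝ] Plane} (L : Plane ≃ₗᵢ[ℝ] Plane)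
    (h : g.linear = L.toLinearEquiv) : IsConformal g := fun u v => by
  rw [h]
  exact L.toLinearIsometry.angle_map u v

/-- The passage to local coordinates of a robot at `o`. -/
def Frame.toAffineEquiv (f : Frame) (o : Plane) : Plane ≃ᵃ[ℝ] Plane :=
  (AffineEquiv.vaddConst ℝ o).symm.trans
    (f.axes.toLinearEquiv.trans
      (LinearEquiv.smulOfNeZero ℝ Plane f.scale f.scale_pos.ne')).toAffineEquiv

theorem Frame.toAffineEquiv_apply (f : Frame) (o x : Plane) :
    f.toAffineEquiv o x = f.toLocal (x - o) := rfl

theorem Frame.isConformal (f : Frame) (o : Plane) : IsConformal (f.toAffineEquiv o) := fun u v => by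
  have h : ∀ w, (f.toAffineEquiv o).linear w = f.scale • f.axes w := fun _ => rfl
  rw [h, h, InnerProductGeometry.angle_smul_smul f.scale_pos.ne']
  exact f.axes.toLinearIsometry.angle_map u v

/-- The reflection in the perpendicular bisector of `B` and `C`. -/
def mirror (B C : Plane) : Plane ≃ᵃ[ℝ] Plane :=
  ((AffineEquiv.vaddConst ℝ (midpoint ℝ B C)).symm.trans
    (ℝ ∙ (C - B))ᗮ.reflection.toLinearEquiv.toAffineEquiv).trans
    (AffineEquiv.vaddConst ℝ (midpoint ℝ B C))

theorem isConformal_mirror (B C : Plane) : IsConformal (mirror B C) :=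
  isConformal_of_isometry (ℝ ∙ (C - B))ᗮ.reflection rfl

theorem mirror_mirror (B C x : Plane) : mirror B C (mirror B C x) = x := by
  simp [mirror]

theorem mirror_apply (B C x : Plane) :
    mirror B C x = x -
      (2 * (inner ℝ (C - B) (x - midpoint ℝ B C) / ‖C - B‖ ^ 2)) • (C - B) := by
  have h : mirror B C x =
      (ℝ ∙ (C - B))ᗮ.reflection (x - midpoint ℝ B C) + midpoint ℝ B C := rfl
  rw [h, Submodule.reflection_orthogonal_apply, Submodule.reflection_singleton_apply]
  simp only [RCLike.ofReal_real_eq_id, id]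
  module

theorem mirror_left (B C : Plane) : mirror B C B = C := by
  by_cases h : C - B = 0
  · rw [mirror_apply, h, smul_zero, sub_zero]
    exact (sub_eq_zero.1 h).symm
  have h1 : B - midpoint ℝ B C = (-(1 / 2) : ℝ) • (C - B) := by
    rw [midpoint_eq_smul_add, invOf_eq_inv]
    module
  have h2 : ‖C - B‖ ^ 2 ≠ 0 := by simpa using h
  rw [mirror_apply, h1, inner_smul_right, real_inner_self_eq_norm_sq, mul_div_assoc, div_self h2]
  module

theorem mirror_right (B C : Plane) : mirror B C C = B := by
  have h := mirror_mirror B C B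
  rwa [mirror_left] at h

theorem inner_mirror_sub (B C x y z w : Plane) :
    inner ℝ (mirror B C x - mirror B C y) (mirror B C z - mirror B C w) =
      inner ℝ (x - y) (z - w) := by
  have h : ∀ x y, mirror B C x - mirror B C y = (ℝ ∙ (C - B))ᗮ.reflection (x - y) :=
    fun x y => ((mirror B C).toAffineMap.linearMap_vsub x y).symm
  rw [h, h, LinearIsometryEquiv.inner_map_map]

/-- Similarities carry perpendicular bisectors to perpendicular bisectors, so the target computed in
local coordinates is the right point of the plane. -/
theorem Frame.mirror_toLocal (f : Frame) (o B C x : Plane) :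
    mirror (f.toLocal (B - o)) (f.toLocal (C - o)) (f.toLocal (x - o)) =
      f.toLocal (mirror B C x - o) := by
  have hsub : ∀ a b, f.toLocal a - f.toLocal b = f.toLocal (a - b) := fun a b => by
    simp only [Frame.toLocal, map_sub, smul_sub]
  have hmid : midpoint ℝ (f.toLocal (B - o)) (f.toLocal (C - o)) =
      f.toLocal (midpoint ℝ B C - o) := by
    have h := ((f.toAffineEquiv o).map_midpoint B C).symm
    exact h
  have hin : ∀ a b, inner ℝ (f.toLocal a) (f.toLocal b) = f.scale ^ 2 * inner ℝ a b := fun a b => by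
    rw [Frame.toLocal, Frame.toLocal, inner_smul_left, inner_smul_right,
      LinearIsometryEquiv.inner_map_map]
    simp only [conj_trivial]
    ring
  have e1 : C - o - (B - o) = C - B := by abel
  have e2 : x - o - (midpoint ℝ B C - o) = x - midpoint ℝ B C := by abel
  rw [mirror_apply, mirror_apply, hmid, hsub, hsub, e1, e2, ← real_inner_self_eq_norm_sq,
    ← real_inner_self_eq_norm_sq, hin, hin,
    mul_div_mul_left _ _ (pow_ne_zero 2 f.scale_pos.ne'), ← f.toLocal_smul, hsub]
  congr 1
  abel

/-! ### The order of the robots along `BC` -/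

/-- A coordinate along the line through the robots `1` and `2`. -/
def coord (p : Config 4) (x : Plane) : ℝ := inner ℝ (x - p 1) (p 1 - p 2)

theorem ConfigI.coord_zero {p : Config 4} (h : ConfigI p) : 0 < coord p (p 0) :=
  (configI_iff.1 h).2.1

theorem coord_one (p : Config 4) : coord p (p 1) = 0 := by
  simp [coord]

theorem ConfigI.coord_two {p : Config 4} (h : ConfigI p) : coord p (p 2) < 0 := by
  have hne : p 1 - p 2 ≠ 0 := by
    intro h0
    have := h.coord_zero
    rw [coord, h0, inner_zero_right] at this
    exact this.false
  rw [coord, ← neg_sub (p 1) (p 2), inner_neg_left, neg_lt_zero]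
  exact real_inner_self_pos.2 hne

theorem ConfigI.coord_three {p : Config 4} (h : ConfigI p) : coord p (p 3) < coord p (p 2) := by
  have := (configI_iff.1 h).2.2.1
  rw [← sub_neg, coord, coord, ← inner_sub_left, sub_sub_sub_cancel_right,
    ← neg_sub (p 2) (p 1), inner_neg_right]
  linarith

theorem ConfigI.coord_nonpos {p : Config 4} (h : ConfigI p) {i : Fin 4} (hi : i ≠ 0) :
    coord p (p i) ≤ 0 := by
  have h1 := coord_one p
  have h2 := h.coord_two
  have h3 := h.coord_three
  fin_cases i
  · exact absurd rfl hi
  · exact h1.le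
  · exact h2.le
  · exact (h3.trans h2).le

/-- The projections to the line `BC` are strictly ordered as `D`, `C`, `B`, `A`, because both outer
angles are acute. -/
theorem ConfigI.injective {p : Config 4} (h : ConfigI p) : Function.Injective p := by
  have h0 := h.coord_zero
  have h1 := coord_one p
  have h2 := h.coord_two
  have h3 := h.coord_three
  intro i j hij
  have := congrArg (coord p) hij
  fin_cases i <;> fin_cases j <;> simp only [Fin.zero_eta, Fin.mk_one, Fin.reduceFinMk] at this ⊢ <;>
    exfalso <;> linarith

/-! ### Recognizing roles from the set of positions -/

theorem exists_perm_of_range_subset {p p' : Config 4} (hp' : Function.Injective p')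
    (h : Set.range p' ⊆ Set.range p) : ∃ σ : Equiv.Perm (Fin 4), p' = p ∘ σ := by
  choose σ hσ using fun i => h (Set.mem_range_self i)
  have hinj : Function.Injective σ := fun i j hij => hp' (by rw [← hσ i, ← hσ j, hij])
  exact ⟨Equiv.ofBijective σ (Finite.injective_iff_bijective.1 hinj), funext fun i => (hσ i).symm⟩

theorem eq_of_range_eq {p p' : Config 4} (hp : p ∈ AE.init) (hp' : p' ∈ AE.init)
    (h : Set.range p' = Set.range p) : p' = p := by
  obtain ⟨σ, rfl⟩ := exists_perm_of_range_subset hp'.1.injective h.le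
  rw [hp.2 σ hp'.1]
  rfl

/-- Robot `0` moved to the mirror image of robot `3`. -/
def symmetrized (p : Config 4) : Config 4 := ![mirror (p 1) (p 2) (p 3), p 1, p 2, p 3]

theorem range_ne_symmetrized {g : Plane ≃ᵃ[ℝ] Plane} (hg : IsConformal g) (p : Config 4)
    {p' : Config 4} (hp' : p' ∈ AE.init) :
    Set.range p' ≠ Set.range (fun i => g (symmetrized p i)) := by
  intro h
  obtain ⟨σ, rfl⟩ := exists_perm_of_range_subset hp'.1.injective h.le
  have hσ : symmetrized p ∘ σ ∈ AE.init := (hg.mem_init_iff (symmetrized p ∘ σ)).1 hp'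
  -- The mirror permutes the four points by `τ`. A labelling `σ` in Configuration (I) therefore
  -- yields a second one, related to it by the conjugate `σ⁻¹ * τ * σ`; uniqueness would force `τ =
  -- 1`.
  let τ : Equiv.Perm (Fin 4) := Equiv.swap 0 3 * Equiv.swap 1 2
  have hτ : ∀ i, mirror (p 1) (p 2) (symmetrized p i) = symmetrized p (τ i) := by
    intro i
    fin_cases i
    · exact mirror_mirror _ _ _
    · exact mirror_left _ _
    · exact mirror_right _ _
    · rfl
  have h1 := ((isConformal_mirror (p 1) (p 2)).configI_iff _).2 hσ.1
  have h2 : (fun i => mirror (p 1) (p 2) ((symmetrized p ∘ σ) i)) =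
      (symmetrized p ∘ σ) ∘ (σ⁻¹ * τ * σ : Equiv.Perm (Fin 4)) := by
    funext i
    simp [hτ]
  rw [h2] at h1
  have h3 := hσ.2 _ h1
  have h4 : τ = 1 := by
    have : τ = σ * (σ⁻¹ * τ * σ) * σ⁻¹ := by group
    rw [this, h3]
    group
  exact absurd h4 (by decide)

theorem snapshot_full {n : ℕ} (f : Frame) (p : Config n) (i : Fin n) :
    snapshot .full f p i = Set.range (fun j => f.toAffineEquiv (p i) (p j)) := by
  ext w
  simp [snapshot, Visibility.Sees, Frame.toAffineEquiv_apply, eq_comm]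

/-! ### The algorithm for AE with full visibility -/

open Classical in
/-- The robot with the smaller angle jumps to the mirror image of its counterpart. -/
def mirrorAlgorithm : Algorithm where
  Color := Unit
  finite_color := inferInstance
  off := ()
  compute := fun _ S =>
    if h : ∃ p ∈ AE.init, Set.range p = S ∧ p 0 = 0 then
      ((), mirror (h.choose 1) (h.choose 2) (h.choose 3))
    else ((), 0)

/-- The chosen labelling has the same point set as the true one in local coordinates, hence equals
it by `eq_of_range_eq`. -/
theorem mirrorAlgorithm_compute_zero (f : Frame) {p : Config 4} (hp : p ∈ AE.init) :
    mirrorAlgorithm.compute () (snapshot .full f p 0) =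
      ((), f.toLocal (mirror (p 1) (p 2) (p 3) - p 0)) := by
  have hp' := ((f.isConformal (p 0)).mem_init_iff p).2 hp
  have h : ∃ p' ∈ AE.init, Set.range p' = snapshot .full f p 0 ∧ p' 0 = 0 :=
    ⟨_, hp', (snapshot_full f p 0).symm, by simp [Frame.toAffineEquiv_apply, Frame.toLocal_zero]⟩
  have hch := eq_of_range_eq hp' h.choose_spec.1
    (h.choose_spec.2.1.trans (snapshot_full f p 0))
  simp only [mirrorAlgorithm, dif_pos h]
  rw [hch]
  exact Prod.ext rfl (f.mirror_toLocal (p 0) (p 1) (p 2) (p 3))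

theorem mirrorAlgorithm_compute_ne_zero (f : Frame) {p : Config 4} (hp : p ∈ AE.init) {i : Fin 4}
    (hi : i ≠ 0) : mirrorAlgorithm.compute () (snapshot .full f p i) = ((), 0) := by
  have h : ¬ ∃ p' ∈ AE.init, Set.range p' = snapshot .full f p i ∧ p' 0 = 0 := by
    rintro ⟨p', hp', hr, h0⟩
    have := eq_of_range_eq (((f.isConformal (p i)).mem_init_iff p).2 hp) hp'
      (hr.trans (snapshot_full f p i))
    have h1 : f.toLocal (p 0 - p i) = f.toLocal 0 := by
      rw [this] at h0
      rw [f.toLocal_zero]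
      exact h0
    exact hi (hp.1.injective (sub_eq_zero.1 (f.toLocal_injective h1))).symm
  simp only [mirrorAlgorithm, dif_neg h]

theorem mirrorAlgorithm_compute_symmetrized (f : Frame) (p : Config 4) (i : Fin 4) :
    mirrorAlgorithm.compute () (snapshot .full f (symmetrized p) i) = ((), 0) := by
  have h : ¬ ∃ p' ∈ AE.init, Set.range p' = snapshot .full f (symmetrized p) i ∧ p' 0 = 0 := by
    rintro ⟨p', hp', hr, -⟩
    exact range_ne_symmetrized (f.isConformal _) p hp' (hr.trans (snapshot_full f _ i))
  simp only [mirrorAlgorithm, dif_neg h]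

open Classical in
theorem mirrorAlgorithm_run_succ (fr : Fin 4 → Frame) (act : ℕ → Set (Fin 4)) {p : Config 4}
    (hp : p ∈ AE.init) {t : ℕ} (h : mirrorAlgorithm.run .full fr act p t = p) :
    mirrorAlgorithm.run .full fr act p (t + 1) = if 0 ∈ act t then symmetrized p else p := by
  have hstep : ∀ i, mirrorAlgorithm.run .full fr act p (t + 1) i =
      if i ∈ act t then p i + (fr i).toGlobal (mirrorAlgorithm.compute ()
        (snapshot .full (fr i) p i)).2 else p i := by
    intro i
    have hs : (fun j => (mirrorAlgorithm.state .full fr act p t j).1) = p := h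
    have hi : (mirrorAlgorithm.state .full fr act p t i).1 = p i := congrFun hs i
    simp only [Algorithm.run, Algorithm.state, Algorithm.step]
    rw [hs]
    split_ifs
    · rw [hi]
      rfl
    · exact hi
  have hne : ∀ i, i ≠ 0 → mirrorAlgorithm.run .full fr act p (t + 1) i = p i := by
    intro i hi
    rw [hstep, mirrorAlgorithm_compute_ne_zero _ hp hi, Frame.toGlobal_zero, add_zero, ite_self]
  have h0 : mirrorAlgorithm.run .full fr act p (t + 1) 0 =
      if 0 ∈ act t then mirror (p 1) (p 2) (p 3) else p 0 := by
    rw [hstep, mirrorAlgorithm_compute_zero _ hp, Frame.toGlobal_toLocal, add_sub_cancel]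
  funext i
  by_cases hi : i = 0
  · subst hi
    rw [h0]
    split_ifs <;> rfl
  · rw [hne i hi]
    split_ifs
    · fin_cases i
      · exact absurd rfl hi
      all_goals rfl
    · rfl

theorem mirrorAlgorithm_run_succ_symmetrized (fr : Fin 4 → Frame) (act : ℕ → Set (Fin 4))
    {p : Config 4} {t : ℕ} (h : mirrorAlgorithm.run .full fr act p t = symmetrized p) :
    mirrorAlgorithm.run .full fr act p (t + 1) = symmetrized p := by
  have hs : (fun j => (mirrorAlgorithm.state .full fr act p t j).1) = symmetrized p := h
  funext i
  have hi : (mirrorAlgorithm.state .full fr act p t i).1 = symmetrized p i := congrFun hs i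
  have hc := mirrorAlgorithm_compute_symmetrized (fr i) p i
  simp only [Algorithm.run, Algorithm.state, Algorithm.step]
  rw [hs]
  split_ifs
  · have : (fr i).toGlobal (mirrorAlgorithm.compute () (snapshot .full (fr i)
        (symmetrized p) i)).2 = 0 := by rw [hc, Frame.toGlobal_zero]
    rw [hi]
    exact (congrArg (symmetrized p i + ·) this).trans (add_zero _)
  · exact hi

/-- The mirror exchanges `B` and `C`, so the acute angle at `C` becomes an acute angle at `B`. -/
theorem ConfigI.coord_mirror {p : Config 4} (h : ConfigI p) :
    0 < coord p (mirror (p 1) (p 2) (p 3)) := by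
  have h1 := inner_mirror_sub (p 1) (p 2) (p 3) (p 2) (p 2) (p 1)
  rw [mirror_left, mirror_right] at h1
  rw [coord, h1]
  exact (configI_iff.1 h).2.2.1

theorem ConfigI.configII_symmetrized {p : Config 4} (h : ConfigI p) :
    ConfigII p (symmetrized p) := by
  have hside : SameSide (p 1) (p 2) (p 3) (p 3) := h.1.symm.trans h.1
  have hangle := (isConformal_mirror (p 1) (p 2)).outerAngle (p 3) (p 2) (p 1)
  rw [mirror_left, mirror_right] at hangle
  refine ⟨?_, hside, hangle, rfl⟩
  change SameSide (p 1) (p 2) (p 0) (mirror (p 1) (p 2) (p 3))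
  -- The mirror displaces `D` parallel to `BC`, hence not across that line.
  rw [mirror_apply, sub_eq_neg_add, ← neg_smul, ← vadd_eq_add, SameSide,
    AffineSubspace.sSameSide_vadd_right_iff]
  · exact h.1
  · rw [direction_affineSpan]
    exact Submodule.smul_mem _ _ (vsub_mem_vectorSpan ℝ (by simp) (by simp))

/-- The start and the target of `A` have positive `coord p`, hence so has the whole segment between
them, while the resting robots have `coord p ≤ 0`. -/
theorem ConfigI.lineMap_ne {p : Config 4} (h : ConfigI p) {x y : Config 4}
    (hx : x = p ∨ x = symmetrized p) (hy : y = p ∨ y = symmetrized p) {i j : Fin 4} (hij : i ≠ j)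
    {u : ℝ} (hu : u ∈ Set.Icc (0 : ℝ) 1) :
    AffineMap.lineMap (x i) (y i) u ≠ AffineMap.lineMap (x j) (y j) u := by
  have hfix : ∀ {z : Config 4}, z = p ∨ z = symmetrized p → ∀ i, i ≠ 0 → z i = p i := by
    rintro z (rfl | rfl) i hi
    · rfl
    · fin_cases i
      · exact absurd rfl hi
      all_goals rfl
  have hstay : ∀ i, i ≠ 0 → AffineMap.lineMap (x i) (y i) u = p i := by
    intro i hi
    rw [hfix hx i hi, hfix hy i hi, AffineMap.lineMap_same_apply]
  have hpos : ∀ {z : Config 4}, z = p ∨ z = symmetrized p → 0 < coord p (z 0) := by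
    rintro z (rfl | rfl)
    · exact h.coord_zero
    · exact h.coord_mirror
  have hmove : 0 < coord p (AffineMap.lineMap (x 0) (y 0) u) := by
    have e : coord p (AffineMap.lineMap (x 0) (y 0) u) =
        (1 - u) * coord p (x 0) + u * coord p (y 0) := by
      have : AffineMap.lineMap (x 0) (y 0) u - p 1 =
          (1 - u) • (x 0 - p 1) + u • (y 0 - p 1) := by
        rw [AffineMap.lineMap_apply_module]
        module
      rw [coord, this, inner_add_left, inner_smul_left, inner_smul_left]
      rfl
    rw [e]
    rcases hu.1.eq_or_lt with h0 | h0
    · rw [← h0]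
      simpa using hpos hx
    · exact add_pos_of_nonneg_of_pos (mul_nonneg (sub_nonneg.2 hu.2) (hpos hx).le)
        (mul_pos h0 (hpos hy))
  have hne : ∀ j, j ≠ 0 →
      AffineMap.lineMap (x 0) (y 0) u ≠ AffineMap.lineMap (x j) (y j) u := by
    intro j hj he
    rw [hstay j hj] at he
    rw [he] at hmove
    exact hmove.not_ge (h.coord_nonpos hj)
  by_cases hi : i = 0
  · subst hi
    exact hne j hij.symm
  by_cases hj : j = 0
  · subst hj
    exact (hne i hi).symm
  rw [hstay i hi, hstay j hj]
  exact h.injective.ne hij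

theorem mirrorAlgorithm_solves (R : Team 4) : Solves mirrorAlgorithm .ssynch .full R AE := by
  classical
  rintro fr - p hp - act ⟨-, hact⟩
  set x := mirrorAlgorithm.run .full fr act p with hx
  have hx0 : x 0 = p := rfl
  have hmem : ∀ t, x t = p ∨ x t = symmetrized p := by
    intro t
    induction t with
    | zero => exact Or.inl rfl
    | succ t ih =>
      rcases ih with ih | ih
      · rw [hx, mirrorAlgorithm_run_succ fr act hp ih]
        split_ifs <;> simp
      · exact Or.inr (mirrorAlgorithm_run_succ_symmetrized fr act ih)
  -- Fairness is needed only once: the first activation of `A` completes the task, and all others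
  -- are harmless.
  obtain ⟨t, -, ht⟩ := hact 0 0
  have hdone : x (t + 1) = symmetrized p := by
    rcases hmem t with h | h
    · rw [hx, mirrorAlgorithm_run_succ fr act hp h, if_pos ht]
    · exact mirrorAlgorithm_run_succ_symmetrized fr act h
  have hfinal : ∀ s, t + 1 ≤ s → x s = symmetrized p := by
    intro s hs
    induction s, hs using Nat.le_induction with
    | base => exact hdone
    | succ s _ ih => exact mirrorAlgorithm_run_succ_symmetrized fr act ih
  refine ⟨fun s => ?_, fun s i j hij u hu => hp.1.lineMap_ne (hmem s) (hmem (s + 1)) hij hu,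
    t + 1, fun s hs => (hfinal s hs).trans hdone.symm, ?_⟩
  · rw [hx0]
    rcases hmem s with h | h <;> rw [h] <;> exact ⟨rfl, rfl⟩
  · rw [hx0, hdone]
    exact hp.1.configII_symmetrized

end

end Robots

theorem mainTheorem1 (V : ℝ) (hV : 0 < V) :
    Robots.Incomparable .fsynch (.limited V) .ssynch .full ∧
    (∀ R : Robots.Team 3, Robots.Solves Robots.algEOSTA .fsynch (.limited V) R Robots.EqOsc) ∧
    (∀ R : Robots.Team 3, Robots.EqOsc ∈ Robots.Task .fsynch (.limited V) R) ∧
    (∃ R : Robots.Team 3, Robots.EqOsc ∉ Robots.Task .ssynch .full R) ∧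
    (∀ R : Robots.Team 4, Robots.AE ∈ Robots.Task .ssynch .full R) ∧
    (∃ R : Robots.Team 4, Robots.AE ∉ Robots.Task .fsynch (.limited V) R) := by
  have h3 (R : Robots.Team 3) : Robots.EqOsc ∈ Robots.Task .fsynch (.limited V) R :=
    ⟨_, Robots.algEOSTA_solves V R⟩
  have h4 (R : Robots.Team 4) : Robots.AE ∈ Robots.Task .ssynch .full R :=
    ⟨_, Robots.mirrorAlgorithm_solves R⟩
  exact ⟨⟨⟨3, Robots.disorientedTeam 3, _, h3 _, Robots.eqOsc_notMem_ssynch _⟩,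
      ⟨4, Robots.disorientedTeam 4, _, h4 _, Robots.AE_notMem_limited hV⟩⟩,
    Robots.algEOSTA_solves V, h3, ⟨Robots.disorientedTeam 3, Robots.eqOsc_notMem_ssynch _⟩, h4,
    ⟨Robots.disorientedTeam 4, Robots.AE_notMem_limited hV⟩⟩
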